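/- For $k\in\mathbb N$, a function $f$ continuous on $I=[-1,1]$ and $t>0$, let $$\omega_k(f,t)=\sup_{0<u\le t}\ \sup_{x\in I}|\Delta_u^k(f,x)|,$$ where $\Delta_u^k(f,x)=\sum_{i=0}^k(-1)^i\binom ki f\bigl(x+(\tfrac k2-i)u\bigr)$ if $x\pm\tfrac{ku}2\in I$, and $\Delta_u^k(f,x)=0$ otherwise, be the $k$-th modulus of smoothness of $f$ on $I$. Theorem. Let $k\in\mathbb N=\{1,2,\dots\}$, $r\in\mathbb N\cup\{0\}$ and $x_0\in I$, and let $\varepsilon:(0,1]\to(0,\infty)$ be a continuous function with $\lim_{x\to0^+}\varepsilon(x)=0$. Then there is a function $F\in C^r[-1,1]$ such that, for every algebraic polynomial $P$ with real coefficients, $$\limsup_{x\to x_0,\ x\in I\setminus\{x_0\}}\frac{|F(x)-P(x)|}{\omega_k\bigl(F^{(r)},\,\varepsilon(|x-x_0|)\,|x-x_0|^{(r+1)/k}\bigr)}=\infty .$$ -/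

import Mathlib

open Set Filter Topology

/-- The `k`-th symmetric difference `Δ^k_u(f, x; J)` of `f` with step `u`: it is
`∑_{i=0}^k (-1)^i (k choose i) f(x + (k/2 - i) u)` if `x ± k u / 2 ∈ J`, and `0` otherwise. -/
noncomputable def symmDifference (k : ℕ) (u : ℝ) (f : ℝ → ℝ) (x : ℝ) (J : Set ℝ) : ℝ :=
  open Classical in
  if x + (k : ℝ) * u / 2 ∈ J ∧ x - (k : ℝ) * u / 2 ∈ J then
    ∑ i ∈ Finset.range (k + 1),
      (-1 : ℝ) ^ i * (k.choose i : ℝ) * f (x + ((k : ℝ) / 2 - (i : ℝ)) * u)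
  else 0

/-- The `k`-th modulus of smoothness
`ω_k(f, t; J) = sup_{0 < u ≤ t} sup_{x ∈ J} |Δ^k_u(f, x; J)|`.
The supremum is the true one whenever `f` is bounded on the interval `J` (for instance if `f` is
continuous on a compact interval) and `t > 0`. -/
noncomputable def modulusOfSmoothness (k : ℕ) (f : ℝ → ℝ) (t : ℝ) (J : Set ℝ) : ℝ :=
  sSup {y : ℝ | ∃ u : ℝ, 0 < u ∧ u ≤ t ∧ ∃ x ∈ J, y = |symmDifference k u f x J|}

/-!
The denominator at distance `d` from `x₀` is a modulus of smoothness with step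
`t = ε(d) d^((r+1)/k)`, so that `t^k = ε(d)^k d^(r+1)`: a fixed smooth `F^(r)` contributes only
`o(d^(r+1))` to it. Hence it suffices to find `F` that, near `x₀`, looks at scale `d n → 0` like a
smooth function with a coefficient of `(x - x₀)^(r+1)` growing with `n`, plus an error invisible at
that scale.

Take `F^(r)(x) = ± g(s (x - x₀))`, where `s = ±1` points from `x₀` into `[-1, 1]` and
`g(y) = c sin y + ∑ₙ aₙ sin (y / aₙ)`. Every term of the series has slope `1` at `0`, so its first
`n + 1` terms have slope `n + 1`; they stay above `(n + 1) y / 2` as long as `y ≤ aₙ`. Given `aₙ`,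
the distance `dₙ ≤ aₙ` is chosen with `ε(dₙ) ≤ aₙ²`, which beats the `k`-th derivatives of these
terms, of size at most `aₙ^(-k)`; then `aₙ₊₁ = aₙ dₙ^(r+1) / 2` makes the remaining terms negligible
at distance `dₙ` (`IsScaleSeq`). So the denominator is `O(dₙ^(r+1))`
(`IsScaleSeq.abs_centralDiff_sineSeries_le`, based on the explicit differences of sines in
`centralDiff_sin`), whereas the `r`-fold primitive `H` of `g` satisfies `H(dₙ) / dₙ^(r+1) → ∞`
(`IsScaleSeq.le_sineSeries`, `le_iteratedPrimitive`).

Subtracting a polynomial does not help: `H(d) = o(d^r)`, so a polynomial of order `≤ r` at `0`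
dominates `H`, and one of higher order is `O(d^(r+1))` (`tendsto_abs_sub_eval_div_pow`).

The constant `c ∈ [0, 1]` ensures that the modulus never vanishes: if all small-step `k`-th
differences of the series happened to be zero, adding `sin` makes them nonzero
(`exists_centralDiff_add_sin_ne_zero`).
-/

/-! ### Central differences -/

/-- The `k`-th central difference of `f : ℝ → ℝ` with step `u` at `y`, with no restriction on the
points; `u` may be of either sign. -/
noncomputable def centralDiff (k : ℕ) (u : ℝ) (f : ℝ → ℝ) (y : ℝ) : ℝ :=
  ∑ i ∈ Finset.range (k + 1),
    (-1 : ℝ) ^ i * (k.choose i : ℝ) * f (y + ((k : ℝ) / 2 - (i : ℝ)) * u)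

theorem centralDiff_add (k : ℕ) (u : ℝ) (f g : ℝ → ℝ) (y : ℝ) :
    centralDiff k u (fun z => f z + g z) y = centralDiff k u f y + centralDiff k u g y := by
  simp only [centralDiff, ← Finset.sum_add_distrib, mul_add]

theorem centralDiff_const_mul (k : ℕ) (u c : ℝ) (f : ℝ → ℝ) (y : ℝ) :
    centralDiff k u (fun z => c * f z) y = c * centralDiff k u f y := by
  simp only [centralDiff, Finset.mul_sum]
  exact Finset.sum_congr rfl fun i _ => by ring

theorem centralDiff_sum {ι : Type*} (s : Finset ι) (k : ℕ) (u : ℝ) (f : ι → ℝ → ℝ) (y : ℝ) :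
    centralDiff k u (fun z => ∑ j ∈ s, f j z) y = ∑ j ∈ s, centralDiff k u (f j) y := by
  simp only [centralDiff, Finset.mul_sum]
  exact Finset.sum_comm

theorem centralDiff_comp_affine (k : ℕ) (u s x₀ : ℝ) (g : ℝ → ℝ) (x : ℝ) :
    centralDiff k u (fun z => g (s * (z - x₀))) x = centralDiff k (s * u) g (s * (x - x₀)) := by
  simp only [centralDiff]
  refine Finset.sum_congr rfl fun i _ => ?_
  congr 2
  ring

theorem abs_centralDiff_le {k : ℕ} {f : ℝ → ℝ} {C : ℝ} (hf : ∀ z, |f z| ≤ C) (u y : ℝ) :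
    |centralDiff k u f y| ≤ 2 ^ k * C := by
  have hsum : ∑ i ∈ Finset.range (k + 1), (k.choose i : ℝ) = 2 ^ k := by
    exact_mod_cast Nat.sum_range_choose k
  rw [← hsum, Finset.sum_mul]
  refine (Finset.abs_sum_le_sum_abs _ _).trans (Finset.sum_le_sum fun i _ => ?_)
  rw [abs_mul, abs_mul, abs_pow, abs_neg, abs_one, one_pow, one_mul, Nat.abs_cast]
  exact mul_le_mul_of_nonneg_left (hf _) (Nat.cast_nonneg _)

/-- Central differences act on the exponential `z ↦ exp (i c z)` as multiplication by
`(exp (i c u / 2) - exp (-i c u / 2)) ^ k`; this is the imaginary part of that identity. -/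
theorem centralDiff_sin (k : ℕ) (u c y : ℝ) :
    centralDiff k u (fun z => Real.sin (c * z)) y =
      (2 * Real.sin (c * u / 2)) ^ k * Real.sin (c * y + k * (Real.pi / 2)) := by
  set p : ℂ := Complex.exp ((c * u / 2 : ℝ) * Complex.I) with hp
  set q : ℂ := Complex.exp (-(c * u / 2 : ℝ) * Complex.I) with hq
  have hpq : p - q = (2 * Real.sin (c * u / 2) : ℝ) * Complex.I := by
    have h := Complex.two_sin ((c * u / 2 : ℝ) : ℂ)
    rw [← hp, ← hq] at h
    rw [Complex.ofReal_mul, Complex.ofReal_sin, Complex.ofReal_ofNat, h]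
    linear_combination (p - q) * Complex.I_mul_I
  have hI : Complex.I = Complex.exp ((Real.pi / 2 : ℝ) * Complex.I) := by
    push_cast
    exact (Complex.exp_pi_div_two_mul_I).symm
  have him : ∀ t : ℝ, Real.sin t = (Complex.exp (t * Complex.I)).im := fun t =>
    (Complex.exp_ofReal_mul_I_im t).symm
  have key : Complex.exp ((c * y : ℝ) * Complex.I) * (p - q) ^ k =
      ∑ i ∈ Finset.range (k + 1), (((-1 : ℝ) ^ i * (k.choose i : ℝ) : ℝ) : ℂ) *
        Complex.exp ((c * (y + ((k : ℝ) / 2 - (i : ℝ)) * u) : ℝ) * Complex.I) := by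
    rw [sub_eq_neg_add, add_pow, Finset.mul_sum]
    refine Finset.sum_congr rfl fun i hi => ?_
    have hik : i ≤ k := Nat.lt_succ_iff.mp (Finset.mem_range.mp hi)
    have hexp : Complex.exp ((c * (y + ((k : ℝ) / 2 - (i : ℝ)) * u) : ℝ) * Complex.I) =
        Complex.exp ((c * y : ℝ) * Complex.I) * (q ^ i * p ^ (k - i)) := by
      rw [hp, hq, ← Complex.exp_nat_mul, ← Complex.exp_nat_mul, ← Complex.exp_add,
        ← Complex.exp_add, Nat.cast_sub hik]
      congr 1
      push_cast
      ring
    rw [hexp, neg_pow]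
    push_cast
    ring
  have hsum : centralDiff k u (fun z => Real.sin (c * z)) y =
      (Complex.exp ((c * y : ℝ) * Complex.I) * (p - q) ^ k).im := by
    rw [key, Complex.im_sum]
    refine Finset.sum_congr rfl fun i _ => ?_
    rw [Complex.im_ofReal_mul, ← him]
  have hpow : Complex.exp ((c * y : ℝ) * Complex.I) * (p - q) ^ k =
      (((2 * Real.sin (c * u / 2)) ^ k : ℝ) : ℂ) *
        Complex.exp ((c * y + k * (Real.pi / 2) : ℝ) * Complex.I) := by
    rw [hpq, mul_pow, hI, ← Complex.exp_nat_mul, ← hI, mul_left_comm, ← Complex.exp_add]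
    push_cast
    congr 2
    ring
  rw [hsum, hpow, Complex.im_ofReal_mul, ← him]

theorem abs_centralDiff_sin_le (k : ℕ) (u c y : ℝ) :
    |centralDiff k u (fun z => Real.sin (c * z)) y| ≤ |c * u| ^ k := by
  rw [centralDiff_sin, abs_mul, abs_pow]
  have h1 : |2 * Real.sin (c * u / 2)| ≤ |c * u| := by
    have h := Real.abs_sin_le_abs (x := c * u / 2)
    rw [abs_div, abs_two] at h
    rw [abs_mul, abs_two]
    linarith
  calc _ ≤ |c * u| ^ k * 1 := by
        gcongr
        exact Real.abs_sin_le_one _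
    _ = _ := mul_one _

/-- At `y = 1/2` every central difference of `sin` with a small step is nonzero, because `π > 3`
excludes `1/2 + k π/2 ∈ ℤ π`. -/
theorem centralDiff_sin_half_ne_zero (k : ℕ) {u : ℝ} (hu : u ≠ 0) (hu1 : |u| ≤ 1) :
    centralDiff k u Real.sin (1 / 2) ≠ 0 := by
  have h := centralDiff_sin k u 1 (1 / 2)
  simp only [one_mul] at h
  have h' : centralDiff k u Real.sin (1 / 2) =
    (2 * Real.sin (u / 2)) ^ k * Real.sin (1 / 2 + k * (Real.pi / 2)) := h
  rw [h']
  have hpi := Real.pi_gt_three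
  obtain ⟨hl, hr⟩ := abs_le.mp hu1
  refine mul_ne_zero (pow_ne_zero _ (mul_ne_zero two_ne_zero fun h0 => hu ?_)) fun h0 => ?_
  · have := (Real.sin_eq_zero_iff_of_lt_of_lt (by linarith) (by linarith)).mp h0
    linarith
  · obtain ⟨n, hn⟩ := Real.sin_eq_zero_iff.mp h0
    have h1 : ((2 * n - k : ℤ) : ℝ) * Real.pi = 1 := by
      push_cast
      linarith
    have h2 : 2 * n - (k : ℤ) ≠ 0 := fun h2 => by
      rw [h2] at h1
      norm_num at h1
    have h3 : (1 : ℝ) ≤ |((2 * n - k : ℤ) : ℝ)| := by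
      exact_mod_cast Int.one_le_abs h2
    have h4 : |((2 * n - k : ℤ) : ℝ)| * Real.pi = 1 := by
      rw [← abs_of_pos Real.pi_pos, ← abs_mul, h1, abs_one]
    nlinarith

/-! ### The modulus of smoothness on a convex set -/

theorem symmDifference_eq_centralDiff {k : ℕ} {u x : ℝ} {f g : ℝ → ℝ} {J : Set ℝ}
    (hJ : Convex ℝ J) (hfg : EqOn f g J)
    (h : x + (k : ℝ) * u / 2 ∈ J ∧ x - (k : ℝ) * u / 2 ∈ J) :
    symmDifference k u f x J = centralDiff k u g x := by
  rw [symmDifference, if_pos h, centralDiff]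
  refine Finset.sum_congr rfl fun i hi => ?_
  have hik : (i : ℝ) ≤ k := by exact_mod_cast Nat.lt_succ_iff.mp (Finset.mem_range.mp hi)
  rw [hfg]
  rcases Nat.eq_zero_or_pos k with rfl | hk
  · have hi0 : (i : ℝ) = 0 := le_antisymm (by simpa using hik) (Nat.cast_nonneg i)
    simpa [hi0] using h.1
  · have hk' : (0 : ℝ) < k := by exact_mod_cast hk
    have := hJ h.1 h.2 (a := 1 - i / k) (b := i / k) (sub_nonneg.mpr ((div_le_one hk').mpr hik))
      (by positivity) (by ring)
    convert this using 1
    simp only [smul_eq_mul]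
    field_simp
    ring

theorem abs_symmDifference_le {k : ℕ} {u x B : ℝ} {f g : ℝ → ℝ} {J : Set ℝ}
    (hJ : Convex ℝ J) (hfg : EqOn f g J) (hB : |centralDiff k u g x| ≤ B) :
    |symmDifference k u f x J| ≤ B := by
  by_cases h : x + (k : ℝ) * u / 2 ∈ J ∧ x - (k : ℝ) * u / 2 ∈ J
  · rwa [symmDifference_eq_centralDiff hJ hfg h]
  · rw [symmDifference, if_neg h, abs_zero]
    exact (abs_nonneg _).trans hB

theorem modulusOfSmoothness_le {k : ℕ} {t B : ℝ} {f g : ℝ → ℝ} {J : Set ℝ}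
    (hJ : Convex ℝ J) (hfg : EqOn f g J) (hB0 : 0 ≤ B)
    (hB : ∀ u, 0 < u → u ≤ t → ∀ x, |centralDiff k u g x| ≤ B) :
    modulusOfSmoothness k f t J ≤ B := by
  refine Real.sSup_le ?_ hB0
  rintro _ ⟨u, hu0, hut, x, -, rfl⟩
  exact abs_symmDifference_le hJ hfg (hB u hu0 hut x)

theorem modulusOfSmoothness_pos {k : ℕ} {t C u x : ℝ} {f g : ℝ → ℝ} {J : Set ℝ}
    (hJ : Convex ℝ J) (hfg : EqOn f g J) (hC : ∀ z, |g z| ≤ C)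
    (hu0 : 0 < u) (hut : u ≤ t) (hx : x ∈ J)
    (h : x + (k : ℝ) * u / 2 ∈ J ∧ x - (k : ℝ) * u / 2 ∈ J) (hne : centralDiff k u g x ≠ 0) :
    0 < modulusOfSmoothness k f t J := by
  refine (abs_pos.mpr hne).trans_le (le_csSup ⟨2 ^ k * C, ?_⟩
    ⟨u, hu0, hut, x, hx, by rw [symmDifference_eq_centralDiff hJ hfg h]⟩)
  rintro _ ⟨v, -, -, z, -, rfl⟩
  exact abs_symmDifference_le hJ hfg (abs_centralDiff_le hC v z)

/-! ### Iterated primitives -/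

/-- The `r`-fold primitive of `f` whose derivatives of order `< r` vanish at `0`. -/
noncomputable def iteratedPrimitive : ℕ → (ℝ → ℝ) → ℝ → ℝ
  | 0, f => f
  | r + 1, f => fun y => ∫ t in (0 : ℝ)..y, iteratedPrimitive r f t

theorem continuous_iteratedPrimitive {f : ℝ → ℝ} (hf : Continuous f) (r : ℕ) :
    Continuous (iteratedPrimitive r f) := by
  cases r with
  | zero => exact hf
  | succ r =>
    exact intervalIntegral.continuous_primitive
      (fun a b => (continuous_iteratedPrimitive hf r).intervalIntegrable a b) 0

theorem deriv_iteratedPrimitive_succ {f : ℝ → ℝ} (hf : Continuous f) (r : ℕ) :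
    deriv (iteratedPrimitive (r + 1) f) = iteratedPrimitive r f :=
  funext fun y => (continuous_iteratedPrimitive hf r).deriv_integral _ 0 y

theorem contDiff_iteratedPrimitive {f : ℝ → ℝ} (hf : Continuous f) (r : ℕ) :
    ContDiff ℝ r (iteratedPrimitive r f) := by
  induction r with
  | zero => exact contDiff_zero.mpr hf
  | succ r ih =>
    push_cast
    refine contDiff_succ_iff_deriv.mpr ⟨fun y => ?_, fun h => by simp at h, ?_⟩
    · exact ((continuous_iteratedPrimitive hf r).integral_hasStrictDerivAt
        0 y).hasDerivAt.differentiableAt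
    · rwa [deriv_iteratedPrimitive_succ hf]

theorem iteratedDeriv_iteratedPrimitive {f : ℝ → ℝ} (hf : Continuous f) (r : ℕ) :
    iteratedDeriv r (iteratedPrimitive r f) = f := by
  induction r with
  | zero => exact iteratedDeriv_zero
  | succ r ih => rw [iteratedDeriv_succ', deriv_iteratedPrimitive_succ hf, ih]

theorem iteratedPrimitive_mono {f g : ℝ → ℝ} (hf : Continuous f) (hg : Continuous g) {d : ℝ}
    (hfg : ∀ y ∈ Icc 0 d, f y ≤ g y) (r : ℕ) :
    ∀ y ∈ Icc 0 d, iteratedPrimitive r f y ≤ iteratedPrimitive r g y := by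
  induction r with
  | zero => exact hfg
  | succ r ih =>
    intro y hy
    exact intervalIntegral.integral_mono_on hy.1
      ((continuous_iteratedPrimitive hf r).intervalIntegrable _ _)
      ((continuous_iteratedPrimitive hg r).intervalIntegrable _ _)
      fun t ht => ih t ⟨ht.1, ht.2.trans hy.2⟩

theorem iteratedPrimitive_affine (A B : ℝ) (r : ℕ) :
    iteratedPrimitive r (fun y => A * y + B) =
      fun y => A * (y ^ (r + 1) / (r + 1).factorial) + B * (y ^ r / r.factorial) := by
  induction r with
  | zero => simp [iteratedPrimitive]
  | succ r ih =>
    funext y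
    simp only [iteratedPrimitive, ih]
    rw [intervalIntegral.integral_add (Continuous.intervalIntegrable (by fun_prop) _ _)
      (Continuous.intervalIntegrable (by fun_prop) _ _), intervalIntegral.integral_const_mul,
      intervalIntegral.integral_const_mul, intervalIntegral.integral_div,
      intervalIntegral.integral_div, integral_pow, integral_pow, Nat.factorial_succ (r + 1),
      Nat.factorial_succ r]
    push_cast
    simp only [ne_eq, Nat.add_eq_zero_iff, one_ne_zero, and_false, not_false_eq_true, zero_pow,
      sub_zero]
    field_simp

theorem le_iteratedPrimitive {g : ℝ → ℝ} (hg : Continuous g) {A B d : ℝ} (hd : 0 ≤ d)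
    (h : ∀ y ∈ Icc 0 d, A * y + B ≤ g y) (r : ℕ) :
    A * (d ^ (r + 1) / (r + 1).factorial) + B * (d ^ r / r.factorial) ≤
      iteratedPrimitive r g d := by
  have := iteratedPrimitive_mono (f := fun y => A * y + B) (by fun_prop) hg h r d ⟨hd, le_rfl⟩
  rwa [iteratedPrimitive_affine] at this

theorem iteratedPrimitive_le {g : ℝ → ℝ} (hg : Continuous g) {A B d : ℝ} (hd : 0 ≤ d)
    (h : ∀ y ∈ Icc 0 d, g y ≤ A * y + B) (r : ℕ) :
    iteratedPrimitive r g d ≤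
      A * (d ^ (r + 1) / (r + 1).factorial) + B * (d ^ r / r.factorial) := by
  have := iteratedPrimitive_mono (g := fun y => A * y + B) hg (by fun_prop) h r d ⟨hd, le_rfl⟩
  rwa [iteratedPrimitive_affine] at this

/-- An `r`-fold primitive of a function vanishing at `0` is `o(d ^ r)` as `d → 0+`. -/
theorem tendsto_iteratedPrimitive_div_pow {g : ℝ → ℝ} (hg : Continuous g) (hg0 : g 0 = 0) (r : ℕ) :
    Tendsto (fun d => iteratedPrimitive r g d / d ^ r) (𝓝[>] 0) (𝓝 0) := by
  rw [Metric.tendsto_nhdsWithin_nhds]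
  intro e he
  obtain ⟨δ, hδ, h⟩ := Metric.continuous_iff.mp hg 0 (e / 2) (by positivity)
  refine ⟨δ, hδ, fun {d} hd hdδ => ?_⟩
  have hd0 : 0 < d := hd
  have hb : ∀ y ∈ Icc 0 d, |g y| ≤ e / 2 := fun y hy => by
    have := h y (by
      rw [Real.dist_eq, sub_zero, abs_of_nonneg hy.1]
      rw [Real.dist_eq, sub_zero, abs_of_pos hd0] at hdδ
      exact hy.2.trans_lt hdδ)
    rw [hg0, Real.dist_eq, sub_zero] at this
    exact this.le
  have h1 := le_iteratedPrimitive hg (A := 0) (B := -(e / 2)) hd0.le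
    (fun y hy => by have := (abs_le.mp (hb y hy)).1; linarith) r
  have h2 := iteratedPrimitive_le hg (A := 0) (B := e / 2) hd0.le
    (fun y hy => by have := (abs_le.mp (hb y hy)).2; linarith) r
  have hp : 0 < d ^ r := pow_pos hd0 r
  have hf : d ^ r / (r.factorial : ℝ) ≤ d ^ r :=
    div_le_self hp.le (by exact_mod_cast Nat.succ_le_of_lt r.factorial_pos)
  rw [Real.dist_eq, sub_zero, abs_div, abs_of_pos hp, div_lt_iff₀ hp, abs_lt]
  constructor <;> nlinarith

/-! ### Distance to polynomials -/

/-- If `H d / d ^ (r + 1) → ∞` along a sequence `d → 0+` while `H d = o(d ^ r)`, then no polynomial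
can remove the growth: a polynomial vanishing to order `> r` at `0` is `O(d ^ (r + 1))`, and one
vanishing to order `m ≤ r` dominates both `H` and `d ^ (r + 1)`. -/
theorem tendsto_abs_sub_eval_div_pow {H : ℝ → ℝ} {d : ℕ → ℝ} {r : ℕ} (hd : ∀ n, 0 < d n)
    (hd0 : Tendsto d atTop (𝓝 0)) (h1 : Tendsto (fun n => H (d n) / d n ^ (r + 1)) atTop atTop)
    (h0 : Tendsto (fun n => H (d n) / d n ^ r) atTop (𝓝 0)) (Q : Polynomial ℝ) :
    Tendsto (fun n => |H (d n) - Q.eval (d n)| / d n ^ (r + 1)) atTop atTop := by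
  rcases eq_or_ne Q 0 with rfl | hQ
  · refine (tendsto_abs_atTop_atTop.comp h1).congr fun n => ?_
    simp [abs_div, abs_of_pos (hd n)]
  obtain ⟨q, hq, hndvd⟩ := Q.exists_eq_pow_rootMultiplicity_mul_and_not_dvd hQ 0
  set m := Q.rootMultiplicity 0
  have hq0 : q.eval 0 ≠ 0 := fun h => hndvd (Polynomial.dvd_iff_isRoot.mpr h)
  have heval : ∀ x, Q.eval x = x ^ m * q.eval x := fun x => by
    conv_lhs => rw [hq]
    simp
  have hqlim : Tendsto (fun n => q.eval (d n)) atTop (𝓝 (q.eval 0)) :=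
    (q.continuous.tendsto 0).comp hd0
  rcases Nat.lt_or_ge r m with hm | hm
  · obtain ⟨j, hj⟩ : ∃ j, m = r + 1 + j := Nat.exists_eq_add_of_le hm
    have hlim := (((hd0.pow j).mul hqlim).neg)
    refine (tendsto_abs_atTop_atTop.comp (h1.atTop_add hlim)).congr fun n => ?_
    have hn := hd n
    have hp := pow_pos hn (r + 1)
    simp only [Function.comp]
    rw [← abs_of_pos hp, ← abs_div, abs_of_pos hp, heval, hj, pow_add]
    congr 1
    field_simp
    ring
  · obtain ⟨j, rfl : r = m + j⟩ := Nat.exists_eq_add_of_le hm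
    have hlim : Tendsto (fun n => |H (d n) / d n ^ (m + j) * d n ^ j - q.eval (d n)|) atTop
        (𝓝 |0 * 0 ^ j - q.eval 0|) := ((h0.mul (hd0.pow j)).sub hqlim).abs
    rw [zero_mul, zero_sub, abs_neg] at hlim
    have hinv : Tendsto (fun n => (d n ^ (j + 1))⁻¹) atTop atTop := by
      refine tendsto_inv_nhdsGT_zero.comp (tendsto_nhdsWithin_iff.mpr ⟨?_, .of_forall fun n =>
        pow_pos (hd n) _⟩)
      simpa using hd0.pow (j + 1)
    refine (hlim.pos_mul_atTop (abs_pos.mpr hq0) hinv).congr fun n => ?_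
    have hn := hd n
    have hp := pow_pos hn (m + j + 1)
    rw [← abs_of_pos hp, ← abs_div, heval,
      ← abs_of_pos (inv_pos.mpr (pow_pos hn (j + 1))), ← abs_mul]
    congr 1
    field_simp
    ring

/-! ### A lacunary sine series -/

/-- Scales for the lacunary series: `a n` is the wavelength and the amplitude of its `n`-th term,
`d n` the distance at which the first `n + 1` terms are observed. The next amplitude is so small
that the remaining terms cannot be seen at distance `d n`, even relative to `d n ^ (r + 1)`. -/
structure IsScaleSeq (r : ℕ) (a d : ℕ → ℝ) : Prop where
  a_zero : a 0 = 1
  d_pos : ∀ n, 0 < d n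
  d_le : ∀ n, d n ≤ a n
  a_succ : ∀ n, a (n + 1) = a n * d n ^ (r + 1) / 2

theorem exists_isScaleSeq (r : ℕ) {ε : ℝ → ℝ} (hε : Tendsto ε (𝓝[>] 0) (𝓝 0)) :
    ∃ a d : ℕ → ℝ, IsScaleSeq r a d ∧ ∀ n, ε (d n) ≤ a n ^ 2 := by
  have hstep : ∀ b : ℝ, ∃ δ, 0 < b → 0 < δ ∧ δ ≤ b ∧ ε δ ≤ b ^ 2 := fun b => by
    by_cases hb : 0 < b
    · have h1 : ∀ᶠ δ in 𝓝[>] (0 : ℝ), ε δ < b ^ 2 := hε.eventually_lt_const (by positivity)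
      have h2 : ∀ᶠ δ in 𝓝[>] (0 : ℝ), δ ∈ Ioc 0 b := Ioc_mem_nhdsGT hb
      obtain ⟨δ, hδ1, hδ2⟩ := (h1.and h2).exists
      exact ⟨δ, fun _ => ⟨hδ2.1, hδ2.2, hδ1.le⟩⟩
    · exact ⟨0, fun h => absurd h hb⟩
  choose D hD using hstep
  let a : ℕ → ℝ := fun n => Nat.rec 1 (fun _ b => b * D b ^ (r + 1) / 2) n
  have hpos : ∀ n, 0 < a n := fun n => by
    induction n with
    | zero => exact one_pos
    | succ n ih =>
      have := (hD (a n) ih).1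
      change 0 < a n * D (a n) ^ (r + 1) / 2
      positivity
  exact ⟨a, fun n => D (a n), ⟨rfl, fun n => (hD _ (hpos n)).1, fun n => (hD _ (hpos n)).2.1,
    fun n => rfl⟩, fun n => (hD _ (hpos n)).2.2⟩

namespace IsScaleSeq

variable {r : ℕ} {a d : ℕ → ℝ}

theorem a_pos (h : IsScaleSeq r a d) (n : ℕ) : 0 < a n := (h.d_pos n).trans_le (h.d_le n)

theorem a_add_le (h : IsScaleSeq r a d) (n j : ℕ) : a (n + j) ≤ a n * (1 / 2) ^ j := by
  have hle : ∀ m, a m ≤ 1 → a (m + 1) ≤ a m * (1 / 2) := fun m hm => by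
    have h1 : d m ^ (r + 1) ≤ 1 := pow_le_one₀ (h.d_pos m).le ((h.d_le m).trans hm)
    rw [h.a_succ]
    nlinarith [h.a_pos m]
  have hone : ∀ m, a m ≤ 1 := fun m => by
    induction m with
    | zero => exact h.a_zero.le
    | succ m ih => linarith [hle m ih]
  induction j with
  | zero => simp
  | succ j ih =>
    rw [← add_assoc, pow_succ]
    linarith [hle (n + j) (hone _)]

theorem a_le (h : IsScaleSeq r a d) (n : ℕ) : a n ≤ (1 / 2) ^ n := by
  have := h.a_add_le 0 n
  rwa [zero_add, h.a_zero, one_mul] at this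

theorem a_le_one (h : IsScaleSeq r a d) (n : ℕ) : a n ≤ 1 :=
  (h.a_le n).trans (pow_le_one₀ (by norm_num) (by norm_num))

theorem a_anti (h : IsScaleSeq r a d) {i n : ℕ} (hin : i ≤ n) : a n ≤ a i := by
  obtain ⟨j, rfl⟩ := Nat.exists_eq_add_of_le hin
  exact (h.a_add_le i j).trans
    (mul_le_of_le_one_right (h.a_pos i).le (pow_le_one₀ (by norm_num) (by norm_num)))

theorem d_le_one (h : IsScaleSeq r a d) (n : ℕ) : d n ≤ 1 := (h.d_le n).trans (h.a_le_one n)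

theorem tendsto_d (h : IsScaleSeq r a d) : Tendsto d atTop (𝓝 0) :=
  squeeze_zero (fun n => (h.d_pos n).le) (fun n => (h.d_le n).trans (h.a_le n))
    (tendsto_pow_atTop_nhds_zero_of_lt_one (by norm_num) (by norm_num))

theorem succ_mul_a_le_one (h : IsScaleSeq r a d) (n : ℕ) : ((n : ℝ) + 1) * a n ≤ 1 := by
  have h2 : (n : ℝ) + 1 ≤ 2 ^ n := by exact_mod_cast Nat.succ_le_of_lt n.lt_two_pow_self
  calc ((n : ℝ) + 1) * a n ≤ 2 ^ n * (1 / 2) ^ n :=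
        mul_le_mul h2 (h.a_le n) (h.a_pos n).le (by positivity)
    _ = 1 := by rw [← mul_pow]; norm_num

end IsScaleSeq

/-- The series `∑ₙ aₙ sin (y / aₙ)`: all its terms have slope `1` at the origin. -/
noncomputable def sineSeries (a : ℕ → ℝ) (y : ℝ) : ℝ :=
  ∑' n, a n * Real.sin ((a n)⁻¹ * y)

namespace IsScaleSeq

variable {r : ℕ} {a d : ℕ → ℝ}

theorem norm_term_le (h : IsScaleSeq r a d) (n : ℕ) (y : ℝ) :
    ‖a n * Real.sin ((a n)⁻¹ * y)‖ ≤ a n := by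
  rw [norm_mul, Real.norm_of_nonneg (h.a_pos n).le]
  exact mul_le_of_le_one_right (h.a_pos n).le (Real.abs_sin_le_one _)

theorem summable (h : IsScaleSeq r a d) : Summable a :=
  summable_geometric_two.of_nonneg_of_le (fun n => (h.a_pos n).le) h.a_le

theorem continuous_sineSeries (h : IsScaleSeq r a d) : Continuous (sineSeries a) :=
  continuous_tsum (fun _ => by fun_prop) h.summable h.norm_term_le

theorem sineSeries_zero : sineSeries a 0 = 0 := by simp [sineSeries]

theorem abs_tail_le (h : IsScaleSeq r a d) (n : ℕ) (y : ℝ) :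
    |∑' j, a (j + n) * Real.sin ((a (j + n))⁻¹ * y)| ≤ 2 * a n := by
  rw [← Real.norm_eq_abs]
  refine tsum_of_norm_bounded (g := fun j : ℕ => a n * (1 / 2) ^ j) ?_ fun j => ?_
  · rw [mul_comm]
    exact hasSum_geometric_two.mul_left _
  · refine (h.norm_term_le _ y).trans ?_
    rw [add_comm j n]
    exact h.a_add_le n j

theorem abs_sineSeries_le (h : IsScaleSeq r a d) (y : ℝ) : |sineSeries a y| ≤ 2 := by
  have := h.abs_tail_le 0 y
  rwa [h.a_zero, mul_one] at this

theorem sum_add_tail (h : IsScaleSeq r a d) (n : ℕ) (y : ℝ) :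
    sineSeries a y = ∑ j ∈ Finset.range n, a j * Real.sin ((a j)⁻¹ * y) +
      ∑' j, a (j + n) * Real.sin ((a (j + n))⁻¹ * y) :=
  ((Summable.of_norm_bounded h.summable fun j => h.norm_term_le j y).sum_add_tsum_nat_add n).symm

/-- Up to distance `d n` the first `n + 1` terms of the series are in their increasing range. -/
theorem le_sineSeries (h : IsScaleSeq r a d) (n : ℕ) {y : ℝ} (hy : y ∈ Icc 0 (d n)) :
    ((n : ℝ) + 1) / 2 * y + -d n ^ (r + 1) ≤ sineSeries a y := by
  have hterm : ∀ j ∈ Finset.range (n + 1), y / 2 ≤ a j * Real.sin ((a j)⁻¹ * y) := fun j hj => by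
    have haj := h.a_pos j
    have h1 : (a j)⁻¹ * y ≤ 1 := by
      rw [inv_mul_le_one₀ haj]
      exact hy.2.trans ((h.d_le n).trans (h.a_anti (Nat.lt_succ_iff.mp (Finset.mem_range.mp hj))))
    have h0 : 0 ≤ (a j)⁻¹ * y := mul_nonneg (inv_nonneg.mpr haj.le) hy.1
    have hsin := Real.mul_le_sin h0 (by linarith [Real.pi_gt_three])
    have hpi : 1 / 2 ≤ 2 / Real.pi := by
      rw [div_le_div_iff₀ two_pos Real.pi_pos]
      linarith [Real.pi_le_four]
    calc y / 2 = a j * (1 / 2 * ((a j)⁻¹ * y)) := by field_simp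
      _ ≤ a j * (2 / Real.pi * ((a j)⁻¹ * y)) := by gcongr
      _ ≤ _ := by gcongr
  have hsum := Finset.sum_le_sum hterm
  rw [Finset.sum_const, Finset.card_range, nsmul_eq_mul] at hsum
  push_cast at hsum
  have htail := (abs_le.mp (h.abs_tail_le (n + 1) y)).1
  have hp := pow_pos (h.d_pos n) (r + 1)
  have hs : 2 * a (n + 1) ≤ d n ^ (r + 1) := by
    rw [h.a_succ]
    nlinarith [h.a_le_one n]
  rw [h.sum_add_tail (n + 1)]
  linarith

/-- For steps `u` with `|u| ^ k ≤ (a n) ^ (2 k) (d n) ^ (r + 1)` the `k`-th differences of the first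
`n + 1` terms are controlled by their `k`-th derivatives, which are at most `(a n) ^ (-k)`, and
those of the remaining terms by their size. -/
theorem abs_centralDiff_sineSeries_le (h : IsScaleSeq r a d) {k : ℕ} (hk : 1 ≤ k) (n : ℕ) {u : ℝ}
    (hu : |u| ^ k ≤ (a n ^ 2) ^ k * d n ^ (r + 1)) (y : ℝ) :
    |centralDiff k u (sineSeries a) y| ≤ (1 + 2 ^ k) * d n ^ (r + 1) := by
  have han := h.a_pos n
  have hp := pow_pos (h.d_pos n) (r + 1)
  have hterm : ∀ j ∈ Finset.range (n + 1),
      |centralDiff k u (fun z => a j * Real.sin ((a j)⁻¹ * z)) y| ≤ a n * d n ^ (r + 1) :=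
    fun j hj => by
      have hj' := h.a_anti (Nat.lt_succ_iff.mp (Finset.mem_range.mp hj))
      rw [centralDiff_const_mul, abs_mul, abs_of_pos (h.a_pos j)]
      calc _ ≤ 1 * |(a j)⁻¹ * u| ^ k := by
            gcongr
            · exact h.a_le_one j
            · exact abs_centralDiff_sin_le k u _ y
        _ = ((a j)⁻¹) ^ k * |u| ^ k := by
            rw [one_mul, abs_mul, abs_of_pos (inv_pos.mpr (h.a_pos j)), mul_pow]
        _ ≤ ((a n)⁻¹) ^ k * ((a n ^ 2) ^ k * d n ^ (r + 1)) := by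
            have := (h.a_pos j).le
            gcongr
        _ = a n ^ k * d n ^ (r + 1) := by
            rw [← mul_assoc, ← mul_pow]
            congr 2
            field_simp
        _ ≤ a n * d n ^ (r + 1) := by
            gcongr
            exact pow_le_of_le_one han.le (h.a_le_one n) (by omega)
  have htail := abs_centralDiff_le (k := k) (h.abs_tail_le (n + 1)) u y
  have heq : sineSeries a = fun z => ∑ j ∈ Finset.range (n + 1), a j * Real.sin ((a j)⁻¹ * z) +
      ∑' j, a (j + (n + 1)) * Real.sin ((a (j + (n + 1)))⁻¹ * z) :=
    funext fun z => h.sum_add_tail (n + 1) z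
  have hs : 2 * a (n + 1) ≤ d n ^ (r + 1) := by
    rw [h.a_succ]
    nlinarith [h.a_le_one n]
  have hsum : |∑ j ∈ Finset.range (n + 1),
      centralDiff k u (fun z => a j * Real.sin ((a j)⁻¹ * z)) y| ≤ d n ^ (r + 1) := by
    refine (Finset.abs_sum_le_sum_abs _ _).trans ((Finset.sum_le_sum hterm).trans ?_)
    rw [Finset.sum_const, Finset.card_range, nsmul_eq_mul, ← mul_assoc]
    push_cast
    exact mul_le_of_le_one_left hp.le (h.succ_mul_a_le_one n)
  rw [heq, centralDiff_add, centralDiff_sum]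
  calc _ ≤ _ := abs_add_le _ _
    _ ≤ d n ^ (r + 1) + 2 ^ k * d n ^ (r + 1) :=
      add_le_add hsum (htail.trans (by gcongr))
    _ = _ := by ring

end IsScaleSeq

/-! ### The extremal function -/

/-- Adding `sin`, if necessary, makes a function have nonzero `k`-th differences with arbitrarily
small steps inside `[-1, 1]`: if all differences of `g` with small steps vanish, then those of
`g + sin` are those of `sin`. The coordinate is `s (x - x₀)`, where `s = ±1` points from `x₀` into
the interval. -/
theorem exists_centralDiff_add_sin_ne_zero {k : ℕ} (hk : 1 ≤ k) {s x₀ : ℝ} (hs : s = 1 ∨ s = -1)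
    (hin : ∀ y ∈ Icc (0 : ℝ) 1, x₀ + s * y ∈ Icc (-1 : ℝ) 1) (g : ℝ → ℝ) :
    ∃ c ∈ Icc (0 : ℝ) 1, ∀ t, 0 < t → ∃ u, 0 < u ∧ u ≤ t ∧ ∃ x ∈ Icc (-1 : ℝ) 1,
      (x + (k : ℝ) * u / 2 ∈ Icc (-1 : ℝ) 1 ∧ x - (k : ℝ) * u / 2 ∈ Icc (-1 : ℝ) 1) ∧
      centralDiff k (s * u) (fun z => c * Real.sin z + g z) (s * (x - x₀)) ≠ 0 := by
  by_cases h : ∀ t, 0 < t → ∃ u, 0 < u ∧ u ≤ t ∧ ∃ x ∈ Icc (-1 : ℝ) 1,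
      (x + (k : ℝ) * u / 2 ∈ Icc (-1 : ℝ) 1 ∧ x - (k : ℝ) * u / 2 ∈ Icc (-1 : ℝ) 1) ∧
      centralDiff k (s * u) g (s * (x - x₀)) ≠ 0
  · exact ⟨0, by simp, by simpa using h⟩
  push Not at h
  obtain ⟨t₀, ht₀, h⟩ := h
  refine ⟨1, by simp, fun t ht => ?_⟩
  have hk' : (1 : ℝ) ≤ k := by exact_mod_cast hk
  have hk0 : (0 : ℝ) < k := one_pos.trans_le hk'
  set u := min (min t t₀) (1 / k) with hu
  have hu0 : 0 < u := lt_min (lt_min ht ht₀) (by positivity)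
  have huk : k * u ≤ 1 := by
    have : u ≤ 1 / k := min_le_right _ _
    rwa [le_div_iff₀' hk0] at this
  have hu1 : u ≤ 1 := by nlinarith
  have hends : x₀ + s * (1 / 2) + (k : ℝ) * u / 2 ∈ Icc (-1 : ℝ) 1 ∧
      x₀ + s * (1 / 2) - (k : ℝ) * u / 2 ∈ Icc (-1 : ℝ) 1 := by
    have h0 := hin 0 (by simp)
    have h1 := hin 1 (by simp)
    simp only [mem_Icc] at h0 h1 ⊢
    have : 0 < k * u := by positivity
    rcases hs with rfl | rfl <;> refine ⟨⟨?_, ?_⟩, ?_, ?_⟩ <;> linarith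
  have hx := hin (1 / 2) (by norm_num)
  have hss : s * s = 1 := by rcases hs with rfl | rfl <;> norm_num
  have habs : |s * u| = u := by
    rcases hs with rfl | rfl <;> simp [abs_of_pos hu0]
  refine ⟨u, hu0, (min_le_left _ _).trans (min_le_left _ _), _, hx, hends, ?_⟩
  have hg := h u hu0 ((min_le_left _ _).trans (min_le_right _ _)) _ hx hends
  have harg : s * (x₀ + s * (1 / 2) - x₀) = 1 / 2 := by linear_combination (1 / 2) * hss
  rw [centralDiff_add, hg, add_zero, centralDiff_const_mul, one_mul, harg]
  refine centralDiff_sin_half_ne_zero k (fun h0 => ?_) (habs.le.trans hu1)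
  rw [h0, abs_zero] at habs
  exact hu0.ne habs

/-- The reflection or translation `x ↦ s (x - x₀)`, `s = ±1`, turns the `r`-fold primitive of `g`
into a function on `[-1, 1]` whose `r`-th derivative is `± g (s (x - x₀))`. -/
theorem iteratedDerivWithin_iteratedPrimitive_comp {g : ℝ → ℝ} (hg : Continuous g) (r : ℕ)
    (s x₀ : ℝ) :
    EqOn (iteratedDerivWithin r (fun x => iteratedPrimitive r g (s * (x - x₀))) (Icc (-1) 1))
      (fun x => s ^ r * g (s * (x - x₀))) (Icc (-1) 1) := by
  intro x hx
  have hc := contDiff_iteratedPrimitive hg r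
  have hcomp : ContDiff ℝ r (fun x => iteratedPrimitive r g (s * (x - x₀))) :=
    hc.comp (by fun_prop)
  rw [iteratedDerivWithin_eq_iteratedDeriv (uniqueDiffOn_Icc (by norm_num)) hcomp.contDiffAt hx,
    iteratedDeriv_comp_sub_const r (fun z => iteratedPrimitive r g (s * z)) x₀,
    iteratedDeriv_comp_const_mul hc, iteratedDeriv_iteratedPrimitive hg]

theorem limsup_eq_top_of_tendsto_atTop {X : Type*} {f : X → ℝ} {l : Filter X} {x : ℕ → X}
    (hx : Tendsto x atTop l) (hf : Tendsto (fun n => f (x n)) atTop atTop) :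
    limsup (fun z => (f z : EReal)) l = ⊤ := by
  refine top_le_iff.mp ?_
  rw [← (EReal.tendsto_coe_nhds_top_iff.mpr hf).limsup_eq]
  exact (limsup_comp (fun z => (f z : EReal)) x atTop).le.trans (limsup_le_limsup_of_le hx)

theorem mainTheorem8 (k r : ℕ) (hk : 1 ≤ k) (x₀ : ℝ) (hx₀ : x₀ ∈ Icc (-1 : ℝ) 1)
    (ε : ℝ → ℝ) (hεpos : ∀ x ∈ Ioc (0 : ℝ) 1, 0 < ε x)
    (hεcont : ContinuousOn ε (Ioc (0 : ℝ) 1))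
    (hεlim : Tendsto ε (𝓝[>] 0) (𝓝 0)) :
    ∃ F : ℝ → ℝ, ContDiffOn ℝ r F (Icc (-1) 1) ∧
      ∀ P : Polynomial ℝ,
        limsup
          (fun x : ℝ =>
            ((|F x - P.eval x| /
              modulusOfSmoothness k (iteratedDerivWithin r F (Icc (-1) 1))
                (ε |x - x₀| * |x - x₀| ^ (((r : ℝ) + 1) / (k : ℝ))) (Icc (-1) 1) : ℝ) : EReal))
          (𝓝[Icc (-1) 1 \ {x₀}] x₀) = ⊤ := by
  obtain ⟨a, d, h, hεd⟩ := exists_isScaleSeq r hεlim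
  obtain ⟨s, hs, hin⟩ : ∃ s : ℝ, (s = 1 ∨ s = -1) ∧
      ∀ y ∈ Icc (0 : ℝ) 1, x₀ + s * y ∈ Icc (-1 : ℝ) 1 := by
    rcases le_total x₀ 0 with h0 | h0
    · exact ⟨1, .inl rfl, fun y hy => ⟨by linarith [hy.1, hx₀.1], by linarith [hy.2]⟩⟩
    · exact ⟨-1, .inr rfl, fun y hy => ⟨by linarith [hy.2], by linarith [hy.1, hx₀.2]⟩⟩
  have hss : s * s = 1 := by rcases hs with rfl | rfl <;> norm_num
  have habs : |s| = 1 := by rcases hs with rfl | rfl <;> simp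
  have hs0 : s ≠ 0 := fun h0 => by simp [h0] at hss
  obtain ⟨c, hc, hne⟩ := exists_centralDiff_add_sin_ne_zero hk hs hin (sineSeries a)
  -- The modulus must be nonzero for the quotients to be meaningful; this is the role of `c sin`.
  set g : ℝ → ℝ := fun z => c * Real.sin z + sineSeries a z with hg
  have hgc : Continuous g := by
    have := h.continuous_sineSeries
    fun_prop
  have hg0 : g 0 = 0 := by simp [hg, IsScaleSeq.sineSeries_zero]
  have hgle : ∀ z, |s ^ r * g (s * (z - x₀))| ≤ 3 := fun z => by
    rw [abs_mul, abs_pow, habs, one_pow, one_mul]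
    refine (abs_add_le _ _).trans ?_
    rw [abs_mul, abs_of_nonneg hc.1]
    have h1 := mul_le_one₀ hc.2 (abs_nonneg _) (Real.abs_sin_le_one (s * (z - x₀)))
    linarith [h.abs_sineSeries_le (s * (z - x₀))]
  have hglow : ∀ n, ∀ y ∈ Icc 0 (d n), ((n : ℝ) + 1) / 2 * y + -d n ^ (r + 1) ≤ g y :=
    fun n y hy => by
      have hsin := Real.sin_nonneg_of_nonneg_of_le_pi hy.1
        (by linarith [hy.2, h.d_le_one n, Real.pi_gt_three])
      linarith [h.le_sineSeries n hy, mul_nonneg hc.1 hsin]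
  set H := iteratedPrimitive r g
  have hdpos : Tendsto d atTop (𝓝[>] 0) :=
    tendsto_nhdsWithin_iff.mpr ⟨h.tendsto_d, .of_forall h.d_pos⟩
  have hH0 : Tendsto (fun n => H (d n) / d n ^ r) atTop (𝓝 0) :=
    (tendsto_iteratedPrimitive_div_pow hgc hg0 r).comp hdpos
  have hH1 : Tendsto (fun n => H (d n) / d n ^ (r + 1)) atTop atTop := by
    have hlin : Tendsto (fun n : ℕ => (n : ℝ) / (2 * (r + 1).factorial) + -1) atTop atTop :=
      tendsto_atTop_add_const_right _ _
        (tendsto_natCast_atTop_atTop.atTop_div_const (by positivity))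
    refine tendsto_atTop_mono (fun n => ?_) hlin
    have hd := h.d_pos n
    have hp := pow_pos hd (r + 1)
    rw [le_div_iff₀ hp]
    refine le_trans ?_ (le_iteratedPrimitive hgc hd.le (hglow n) r)
    have h1 : d n ^ r / (r.factorial : ℝ) ≤ 1 :=
      div_le_one_of_le₀ ((pow_le_one₀ hd.le (h.d_le_one n)).trans
        (by exact_mod_cast Nat.succ_le_of_lt r.factorial_pos)) (Nat.cast_nonneg _)
    have h2 : (n : ℝ) / (2 * (r + 1).factorial) * d n ^ (r + 1) ≤
        ((n : ℝ) + 1) / 2 * (d n ^ (r + 1) / (r + 1).factorial) := by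
      rw [div_mul_div_comm, div_mul_eq_mul_div]
      gcongr
      linarith
    nlinarith
  refine ⟨fun x => H (s * (x - x₀)),
    ((contDiff_iteratedPrimitive hgc r).comp (by fun_prop)).contDiffOn, fun P => ?_⟩
  have hEq := iteratedDerivWithin_iteratedPrimitive_comp hgc r s x₀
  have hdist : ∀ n, |x₀ + s * d n - x₀| = d n := fun n => by
    rw [add_sub_cancel_left, abs_mul, habs, one_mul, abs_of_pos (h.d_pos n)]
  refine limsup_eq_top_of_tendsto_atTop (x := fun n => x₀ + s * d n) ?_ ?_
  · refine tendsto_nhdsWithin_iff.mpr ⟨?_, .of_forall fun n =>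
      ⟨hin _ ⟨(h.d_pos n).le, h.d_le_one n⟩, fun h0 => ?_⟩⟩
    · simpa using (h.tendsto_d.const_mul s).const_add x₀
    · have h1 := hdist n
      rw [mem_singleton_iff.mp h0, sub_self, abs_zero] at h1
      exact (h.d_pos n).ne h1
  -- Along `x₀ + s d n` the numerator exceeds every multiple of `d n ^ (r + 1)`, while the
  -- denominator is at most `(2 + 2 ^ k) d n ^ (r + 1)`: one unit each for `c sin` and the first
  -- `n + 1` terms of the series, and `2 ^ k` for the remaining terms.
  have hmain := tendsto_abs_sub_eval_div_pow h.d_pos h.tendsto_d hH1 hH0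
    (P.comp (Polynomial.C x₀ + Polynomial.C s * Polynomial.X))
  refine tendsto_atTop_mono (fun n => ?_)
    (hmain.atTop_div_const (show (0 : ℝ) < 2 + 2 ^ k by positivity))
  have hd := h.d_pos n
  have hp := pow_pos hd (r + 1)
  have hε := hεpos (d n) ⟨hd, h.d_le_one n⟩
  simp only [hdist]
  set t := ε (d n) * d n ^ (((r : ℝ) + 1) / (k : ℝ))
  have ht : 0 < t := mul_pos hε (Real.rpow_pos_of_pos hd _)
  have htk : t ^ k ≤ (a n ^ 2) ^ k * d n ^ (r + 1) := by
    have hroot : (d n ^ (((r : ℝ) + 1) / (k : ℝ))) ^ k = d n ^ (r + 1) := by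
      rw [← Real.rpow_natCast, ← Real.rpow_mul hd.le,
        div_mul_cancel₀ _ (by exact_mod_cast (by omega : k ≠ 0))]
      exact_mod_cast Real.rpow_natCast (d n) (r + 1)
    rw [mul_pow, hroot]
    gcongr
    exact hεd n
  have hupper : modulusOfSmoothness k
      (iteratedDerivWithin r (fun x => H (s * (x - x₀))) (Icc (-1) 1)) t (Icc (-1) 1) ≤
      (2 + 2 ^ k) * d n ^ (r + 1) := by
    refine modulusOfSmoothness_le (convex_Icc _ _) hEq (by positivity) fun u hu0 hut x => ?_
    have hu : |s * u| ^ k ≤ (a n ^ 2) ^ k * d n ^ (r + 1) := by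
      rw [abs_mul, habs, one_mul, abs_of_pos hu0]
      exact (pow_le_pow_left₀ hu0.le hut k).trans htk
    have h1 : (a n ^ 2) ^ k * d n ^ (r + 1) ≤ d n ^ (r + 1) :=
      mul_le_of_le_one_left hp.le (pow_le_one₀ (sq_nonneg _)
        (pow_le_one₀ (h.a_pos n).le (h.a_le_one n)))
    rw [centralDiff_const_mul, centralDiff_comp_affine, abs_mul, abs_pow, habs, one_pow, one_mul,
      hg, centralDiff_add, centralDiff_const_mul]
    refine (abs_add_le _ _).trans ?_
    have h2 := h.abs_centralDiff_sineSeries_le hk n hu (s * (x - x₀))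
    have h3 := abs_centralDiff_sin_le k (s * u) 1 (s * (x - x₀))
    simp only [one_mul] at h3
    rw [abs_mul, abs_of_nonneg hc.1]
    have h4 : c * |centralDiff k (s * u) Real.sin (s * (x - x₀))| ≤ d n ^ (r + 1) :=
      (mul_le_of_le_one_left (abs_nonneg _) hc.2).trans (h3.trans (hu.trans h1))
    linarith
  have hlower : 0 < modulusOfSmoothness k
      (iteratedDerivWithin r (fun x => H (s * (x - x₀))) (Icc (-1) 1)) t (Icc (-1) 1) := by
    obtain ⟨u, hu0, hut, x, hx, hends, hux⟩ := hne t ht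
    refine modulusOfSmoothness_pos (convex_Icc _ _) hEq hgle hu0 hut hx hends ?_
    rw [centralDiff_const_mul, centralDiff_comp_affine]
    exact mul_ne_zero (pow_ne_zero r hs0) hux
  have harg : s * (x₀ + s * d n - x₀) = d n := by linear_combination d n * hss
  rw [harg, Polynomial.eval_comp, div_div, mul_comm (d n ^ (r + 1))]
  simp only [Polynomial.eval_add, Polynomial.eval_mul, Polynomial.eval_C, Polynomial.eval_X]
  exact div_le_div_of_nonneg_left (abs_nonneg _) hlower hupper
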